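/- For a well quasi-order $A$, let $\mathrm{Inco}(A)$ be the forest of non-empty finite sequences of pairwise incomparable elements of $A$, where $t$ is a child of $s$ when $t$ extends $s$ by one element. This forest has no infinite branch, so each node has an ordinal rank $r(s)=\sup\{r(t)+1 : t \text{ a child of } s\}$. The width of $A$ is $w(A)=\sup\{r(s)+1 : s\in\mathrm{Inco}(A)\}$. Let $\oplus$ denote the natural (Hessenberg) sum of ordinals, and for an ordinal $\sigma$ let $\sigma-1$ denote the left subtraction, so that $1+(\sigma-1)=\sigma$ when $\sigma\ge 1$. **Theorem.** Let $n\ge 1$, let $\alpha_1\ge\alpha_2\ge\dots\ge\alpha_n\ge 0$ be ordinals, and let $X=\omega^{\alpha_1}\times\dots\times\omega^{\alpha_n}$ be the cartesian product with the componentwise order. If $\alpha_2=\dots=\alpha_n=0$ (in particular if $n=1$), then $w(X)=1$. Otherwise $$w(X)=\omega^{\alpha_1\oplus((\alpha_2\oplus\dots\oplus\alpha_n)-1)}.$$ -/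

import Mathlib

universe u

namespace WqoWidth

/-- A node of the forest `Inco(A)`: a non-empty finite sequence of pairwise incomparable
elements of `A`. -/
def Inco (A : Type u) [Preorder A] : Type u :=
  {l : List A // l ≠ [] ∧ l.Pairwise (IncompRel (· ≤ ·))}

/-- `t` is a child of `s` in `Inco(A)` when `t = s ⌢ y` for some `y`. -/
def Inco.IsChild {A : Type u} [Preorder A] (t s : Inco A) : Prop :=
  ∃ y : A, t.1 = s.1 ++ [y]

/-- The forest of antichain sequences of a well quasi-order has no infinite branch. -/
instance Inco.isWellFounded (A : Type u) [Preorder A] [WellQuasiOrderedLE A] :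
    IsWellFounded (Inco A) Inco.IsChild := by
  refine ⟨wellFounded_iff_isEmpty_descending_chain.2 ⟨?_⟩⟩
  rintro ⟨f, hf⟩
  have hf : ∀ k, ∃ y : A, (f (k + 1)).1 = (f k).1 ++ [y] := hf
  choose y hy using hf
  have hmem : ∀ m k, y m ∈ (f (m + 1 + k)).1 := by
    intro m k
    induction k with
    | zero => simp [hy m]
    | succ k ih =>
      have h := hy (m + 1 + k)
      rw [← Nat.add_assoc, h]
      exact List.mem_append_left _ ih
  obtain ⟨m, k, hmk, hle⟩ := wellQuasiOrdered_le y
  obtain ⟨d, rfl⟩ := Nat.exists_eq_add_of_lt hmk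
  have hp := (f (m + d + 1 + 1)).2.2
  rw [hy (m + d + 1), List.pairwise_append] at hp
  have hm : y m ∈ (f (m + d + 1)).1 := by
    have h := hmem m d
    rwa [Nat.add_right_comm] at h
  exact (hp.2.2 (y m) hm (y (m + d + 1)) (by simp)).1 hle

/-- The width of a well quasi-order `A`: the rank of the forest `Inco(A)`, that is, the supremum
of `r(s) + 1` over all nodes `s`, where `r(s) = sup {r(t) + 1 | t a child of s}`. -/
noncomputable def width (A : Type u) [Preorder A] [WellQuasiOrderedLE A] : Ordinal.{u} :=
  ⨆ s : Inco A, Order.succ (IsWellFounded.rank Inco.IsChild s)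

/-- The natural (Hessenberg) sum of ordinals: the least ordinal strictly greater than
`a' ⊕ b` for all `a' < a` and than `a ⊕ b'` for all `b' < b`. -/
noncomputable def natAdd (a b : Ordinal.{u}) : Ordinal.{u} :=
  max (⨆ x : Set.Iio a, Order.succ (natAdd x.1 b)) (⨆ y : Set.Iio b, Order.succ (natAdd a y.1))
termination_by (a, b)
decreasing_by
  · exact Prod.Lex.left _ _ x.2
  · exact Prod.Lex.right _ y.2

/-- The natural sum of a finite list of ordinals (the empty sum is `0`). -/
noncomputable def natSum (l : List Ordinal.{u}) : Ordinal.{u} :=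
  l.foldr natAdd 0

end WqoWidth

/-! The exponent is rewritten symmetrically: when at least two `α i` are nonzero, `widthExp α` is
the natural sum of all of them, less one unless at least two are infinite. For a decreasing tuple
this is the stated exponent (`widthExp_of_antitone`), because left subtraction of 1 fixes infinite
ordinals. Being symmetric, it allows induction on `α` by lowering any single exponent.

Upper bound: if `y` is incomparable to `x`, then `y i < x i` for some `i`, and `x i < ω ^ η * k`
with `η < α i`. So what may follow `x` is covered by finitely many copies of boxes with one exponent
lowered. Their widths are below `ω ^ widthExp α` (`widthExp_update_lt`), and a union costs at most a
natural sum (`WidthLE.union`), under which powers of `ω` are closed.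

Lower bound: stack `k` copies of a lowered box along coordinate `i` and use them from the top down,
pushing each later copy up in another nontrivial coordinate `j`, past everything already chosen.
This multiplies the rank by `k` (`widthGE_box_update_mul`), and by `exists_le_widthExp_update` the
lowered exponents are cofinal below `widthExp α`. -/

namespace WqoWidth

/-! ### Natural sum of two ordinals -/

section NatAdd

variable {a b c a' b' : Ordinal.{u}}

theorem lt_natAdd_iff :
    c < natAdd a b ↔ (∃ a' < a, c ≤ natAdd a' b) ∨ ∃ b' < b, c ≤ natAdd a b' := by
  rw [natAdd, lt_max_iff, Ordinal.lt_iSup_iff, Ordinal.lt_iSup_iff]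
  simp

theorem natAdd_le_iff :
    natAdd a b ≤ c ↔ (∀ a' < a, natAdd a' b < c) ∧ ∀ b' < b, natAdd a b' < c := by
  rw [← not_lt, lt_natAdd_iff]
  push Not
  rfl

theorem natAdd_lt_natAdd_left (b : Ordinal.{u}) (h : a' < a) : natAdd a' b < natAdd a b :=
  lt_natAdd_iff.2 (Or.inl ⟨a', h, le_rfl⟩)

theorem natAdd_lt_natAdd_right (a : Ordinal.{u}) (h : b' < b) : natAdd a b' < natAdd a b :=
  lt_natAdd_iff.2 (Or.inr ⟨b', h, le_rfl⟩)

theorem natAdd_strictMono (a : Ordinal.{u}) : StrictMono (natAdd a) :=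
  fun _ _ h => natAdd_lt_natAdd_right a h

theorem natAdd_comm (a b : Ordinal.{u}) : natAdd a b = natAdd b a := by
  rw [natAdd, natAdd, max_comm]
  congr 1
  · exact iSup_congr fun y => congrArg _ (natAdd_comm a y.1)
  · exact iSup_congr fun x => congrArg _ (natAdd_comm x.1 b)
termination_by (a, b)
decreasing_by
  · exact Prod.Lex.right _ y.2
  · exact Prod.Lex.left _ _ x.2

@[simp]
theorem natAdd_zero (a : Ordinal.{u}) : natAdd a 0 = a := by
  induction a using WellFoundedLT.induction with
  | _ a ih =>
    refine le_antisymm (natAdd_le_iff.2 ⟨fun a' h => (ih a' h).trans_lt h, by simp⟩) ?_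
    refine le_of_forall_lt fun c hc => ?_
    rw [← ih c hc]
    exact natAdd_lt_natAdd_left 0 hc

theorem natAdd_succ (a b : Ordinal.{u}) : natAdd a (Order.succ b) = Order.succ (natAdd a b) := by
  induction a using WellFoundedLT.induction with
  | _ a ih =>
    refine le_antisymm (natAdd_le_iff.2 ⟨fun a' h => ?_, fun b' h => ?_⟩)
      (Order.succ_le_of_lt (natAdd_lt_natAdd_right a (Order.lt_succ b)))
    · rw [ih a' h]
      exact Order.succ_lt_succ (natAdd_lt_natAdd_left b h)
    · exact Order.lt_succ_of_le
        ((natAdd_strictMono a).monotone (Order.lt_succ_iff.1 h))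

theorem succ_natAdd (a b : Ordinal.{u}) : natAdd (Order.succ a) b = Order.succ (natAdd a b) := by
  rw [natAdd_comm, natAdd_succ, natAdd_comm]

theorem le_natAdd_left (a b : Ordinal.{u}) : a ≤ natAdd a b := by
  have h : StrictMono fun a => natAdd a b := fun _ _ h => natAdd_lt_natAdd_left b h
  exact h.le_apply

theorem le_natAdd_right (a b : Ordinal.{u}) : b ≤ natAdd a b := by
  rw [natAdd_comm]
  exact le_natAdd_left b a

open Ordinal in
/-- Natural addition is bounded coefficientwise when one splits off multiples of `w`. -/
theorem natAdd_mul_add_le {w : Ordinal.{u}} (hw : IsPrincipal natAdd w) (m n : ℕ)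
    {r s : Ordinal.{u}} (hr : r < w) (hs : s < w) :
    natAdd (w * m + r) (w * n + s) ≤ w * (m + n : ℕ) + natAdd r s := by
  have hw0 : w ≠ 0 := (zero_le.trans_lt hr).ne'
  have key : ∀ {x : Ordinal.{u}} {k : ℕ}, x < w * k → ∃ j < k, ∃ t < w, x = w * j + t := by
    intro x k hx
    have hlt : x / w < k := (lt_mul_iff_div_lt hw0).1 hx
    obtain ⟨j, hj⟩ := lt_omega0.1 (hlt.trans (natCast_lt_omega0 k))
    refine ⟨j, by simpa [hj] using hlt, x % w, mod_lt x hw0, ?_⟩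
    rw [← hj, div_add_mod]
  have bound : ∀ {j k : ℕ} {t e : Ordinal.{u}}, j < k → t < w → w * j + t < w * k + e := by
    intro j k t e hjk ht
    calc w * j + t < w * j + w := by gcongr
      _ = w * (j + 1 : ℕ) := by push_cast; rw [mul_add_one]
      _ ≤ w * k := by gcongr; exact_mod_cast hjk
      _ ≤ _ := le_self_add
  refine natAdd_le_iff.2 ⟨fun x hx => ?_, fun x hx => ?_⟩
  -- Lowering an argument either drops its multiple of `w`, a loss that the natural sum of the
  -- remainders (still below `w`) cannot make up, or lowers only its remainder.
  · rcases lt_or_ge x (w * m) with h | h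
    · obtain ⟨j, hj, t, ht, rfl⟩ := key h
      exact (natAdd_mul_add_le hw j n ht hs).trans_lt
        (bound (Nat.add_lt_add_right hj n) (hw ht hs))
    · obtain ⟨t, rfl⟩ := exists_add_of_le h
      have ht : t < r := by simpa using hx
      refine (natAdd_mul_add_le hw m n (ht.trans hr) hs).trans_lt ?_
      gcongr
      exact natAdd_lt_natAdd_left s ht
  · rcases lt_or_ge x (w * n) with h | h
    · obtain ⟨j, hj, t, ht, rfl⟩ := key h
      exact (natAdd_mul_add_le hw m j hr ht).trans_lt
        (bound (Nat.add_lt_add_left hj m) (hw hr ht))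
    · obtain ⟨t, rfl⟩ := exists_add_of_le h
      have ht : t < s := by simpa using hx
      refine (natAdd_mul_add_le hw m n hr (ht.trans hs)).trans_lt ?_
      gcongr
      exact natAdd_lt_natAdd_right r ht
termination_by (w * m + r, w * n + s)
decreasing_by
  · exact Prod.Lex.left _ _ hx
  · exact Prod.Lex.left _ _ hx
  · exact Prod.Lex.right _ hx
  · exact Prod.Lex.right _ hx

open Ordinal in
theorem isPrincipal_natAdd_omega0_opow (g : Ordinal.{u}) : IsPrincipal natAdd (ω ^ g) := by
  induction g using WellFoundedLT.induction with
  | _ g ih =>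
    rcases eq_or_ne g 0 with rfl | hg
    · simp
    intro a b ha hb
    obtain ⟨d, hd, m, hm⟩ := (lt_omega0_opow hg).1 ha
    obtain ⟨e, he, n, hn⟩ := (lt_omega0_opow hg).1 hb
    have hpos : (0 : Ordinal.{u}) < ω ^ max d e := opow_pos _ omega0_pos
    have hm' : a < ω ^ max d e * m := hm.trans_le <|
      mul_le_mul_left (opow_le_opow_right omega0_pos (le_max_left d e)) _
    have hn' : b < ω ^ max d e * n := hn.trans_le <|
      mul_le_mul_left (opow_le_opow_right omega0_pos (le_max_right d e)) _
    have h := natAdd_mul_add_le (ih _ (max_lt hd he)) m n hpos hpos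
    simp only [add_zero, natAdd_zero] at h
    calc natAdd a b < natAdd (ω ^ max d e * m) b := natAdd_lt_natAdd_left _ hm'
      _ < natAdd (ω ^ max d e * m) (ω ^ max d e * n) := natAdd_lt_natAdd_right _ hn'
      _ ≤ _ := h
      _ < _ := opow_mul_lt_opow (natCast_lt_omega0 _) (max_lt hd he)

end NatAdd

/-! ### Natural sums of tuples and changing one entry -/

section NatSum

/-- The natural sum of a finite tuple of ordinals. -/
noncomputable def tupleSum {n : ℕ} (α : Fin n → Ordinal.{u}) : Ordinal.{u} :=
  natSum (List.ofFn α)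

theorem tupleSum_succ {n : ℕ} (α : Fin (n + 1) → Ordinal.{u}) :
    tupleSum α = natAdd (α 0) (tupleSum fun i : Fin n => α i.succ) := by
  simp [tupleSum, natSum, List.ofFn_succ]

theorem tupleSum_update_zero {n : ℕ} (α : Fin (n + 1) → Ordinal.{u}) (η : Ordinal.{u}) :
    tupleSum (Function.update α 0 η) = natAdd η (tupleSum fun i : Fin n => α i.succ) := by
  simp [tupleSum_succ]

theorem tupleSum_update_succ {n : ℕ} (α : Fin (n + 1) → Ordinal.{u}) (i : Fin n)
    (η : Ordinal.{u}) : tupleSum (Function.update α i.succ η) =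
      natAdd (α 0) (tupleSum (Function.update (fun i : Fin n => α i.succ) i η)) := by
  rw [tupleSum_succ, Function.update_of_ne (Fin.succ_ne_zero i).symm]
  exact congrArg (fun β => natAdd (α 0) (tupleSum β)) (Fin.tail_update_succ α i η)

theorem tupleSum_update_lt {n : ℕ} (α : Fin n → Ordinal.{u}) (i : Fin n) {η : Ordinal.{u}}
    (h : η < α i) : tupleSum (Function.update α i η) < tupleSum α := by
  induction n with
  | zero => exact i.elim0
  | succ n ih =>
    rw [tupleSum_succ α]
    cases i using Fin.cases with
    | zero => rw [tupleSum_update_zero]; exact natAdd_lt_natAdd_left _ h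
    | succ i => rw [tupleSum_update_succ]; exact natAdd_lt_natAdd_right _ (ih _ i h)

theorem exists_le_tupleSum_update {n : ℕ} (α : Fin n → Ordinal.{u}) {c : Ordinal.{u}}
    (h : c < tupleSum α) : ∃ i, ∃ η < α i, c ≤ tupleSum (Function.update α i η) := by
  induction n generalizing c with
  | zero => simp [tupleSum, natSum] at h
  | succ n ih =>
    rw [tupleSum_succ] at h
    obtain ⟨a, ha, hc⟩ | ⟨b, hb, hc⟩ := lt_natAdd_iff.1 h
    · exact ⟨0, a, ha, by rwa [tupleSum_update_zero]⟩
    · obtain ⟨i, η, hη, hi⟩ := ih (fun i => α i.succ) hb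
      refine ⟨i.succ, η, hη, hc.trans ?_⟩
      rw [tupleSum_update_succ]
      exact (natAdd_strictMono _).monotone hi

theorem tupleSum_update_add_one {n : ℕ} (α : Fin n → Ordinal.{u}) (i : Fin n) (η : Ordinal.{u}) :
    tupleSum (Function.update α i (Order.succ η)) =
      Order.succ (tupleSum (Function.update α i η)) := by
  induction n with
  | zero => exact i.elim0
  | succ n ih =>
    cases i using Fin.cases with
    | zero => rw [tupleSum_update_zero, tupleSum_update_zero, succ_natAdd]
    | succ i => rw [tupleSum_update_succ, tupleSum_update_succ, ih, natAdd_succ]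

theorem le_tupleSum {n : ℕ} (α : Fin n → Ordinal.{u}) (i : Fin n) : α i ≤ tupleSum α := by
  induction n with
  | zero => exact i.elim0
  | succ n ih =>
    rw [tupleSum_succ]
    cases i using Fin.cases with
    | zero => exact le_natAdd_left _ _
    | succ i => exact (ih (fun i => α i.succ) i).trans (le_natAdd_right _ _)

open Ordinal in
theorem tupleSum_lt_omega0 {n : ℕ} (α : Fin n → Ordinal.{u}) (h : ∀ i, α i < ω) :
    tupleSum α < ω := by
  induction n with
  | zero => simp [tupleSum, natSum, omega0_pos]
  | succ n ih =>
    rw [tupleSum_succ]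
    have hp := isPrincipal_natAdd_omega0_opow.{u} 1
    rw [opow_one] at hp
    exact hp (h 0) (ih _ fun i => h i.succ)

end NatSum

/-! ### Rank bounds for antichain sequences inside a set -/

section Game

universe v w

variable {A : Type v} {B : Type w} [Preorder A] [Preorder B]

/-- The elements of `S` that are incomparable to `x`. -/
def perp (S : Set A) (x : A) : Set A :=
  {y ∈ S | IncompRel (· ≤ ·) x y}

/-- The antichain sequences in `S` form a forest of rank at most `ζ`. -/
inductive WidthLE : Set A → Ordinal.{u} → Prop
  | intro (S : Set A) (ζ : Ordinal.{u}) (f : A → Ordinal.{u}) (hf : ∀ x ∈ S, f x < ζ)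
    (h : ∀ x ∈ S, WidthLE (perp S x) (f x)) : WidthLE S ζ

/-- The antichain sequences in `S` form a forest of rank at least `ζ`. -/
inductive WidthGE : Set A → Ordinal.{u} → Prop
  | intro (S : Set A) (ζ : Ordinal.{u}) (x : Set.Iio ζ → A) (hx : ∀ c, x c ∈ S)
    (h : ∀ c, WidthGE (perp S (x c)) c.1) : WidthGE S ζ

theorem widthLE_iff {S : Set A} {ζ : Ordinal.{u}} :
    WidthLE S ζ ↔ ∀ x ∈ S, ∃ c < ζ, WidthLE (perp S x) c := by
  constructor
  · rintro ⟨_, _, f, hf, h⟩ x hx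
    exact ⟨f x, hf x hx, h x hx⟩
  · intro h
    choose! f hf h using h
    exact ⟨S, ζ, f, hf, h⟩

theorem widthGE_iff {S : Set A} {ζ : Ordinal.{u}} :
    WidthGE S ζ ↔ ∀ c < ζ, ∃ x ∈ S, WidthGE (perp S x) c := by
  constructor
  · rintro ⟨_, _, x, hx, h⟩ c hc
    exact ⟨x ⟨c, hc⟩, hx _, h _⟩
  · intro h
    choose x hx h using h
    exact ⟨S, ζ, fun c => x c.1 c.2, fun c => hx c.1 c.2, fun c => h c.1 c.2⟩

theorem WidthGE.mono {S : Set A} {ζ ξ : Ordinal.{u}} (h : WidthGE S ζ) (hξ : ξ ≤ ζ) :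
    WidthGE S ξ := by
  rw [widthGE_iff] at h ⊢
  exact fun c hc => h c (hc.trans_le hξ)

theorem WidthLE.of_map {T : Set B} {ζ : Ordinal.{u}} (h : WidthLE T ζ) {S : Set A} (f : A → B)
    (hf : Set.MapsTo f S T)
    (hi : ∀ x ∈ S, ∀ y ∈ S, IncompRel (· ≤ ·) x y → IncompRel (· ≤ ·) (f x) (f y)) :
    WidthLE S ζ := by
  induction h generalizing S with
  | intro T ζ g hg _ ih =>
    refine ⟨S, ζ, fun x => g (f x), fun x hx => hg _ (hf hx), fun x hx => ih _ (hf hx) ?_ ?_⟩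
    · exact fun y hy => ⟨hf hy.1, hi x hx y hy.1 hy.2⟩
    · exact fun y hy z hz => hi y hy.1 z hz.1

theorem WidthLE.subset {S T : Set A} {ζ : Ordinal.{u}} (h : WidthLE T ζ) (hST : S ⊆ T) :
    WidthLE S ζ :=
  h.of_map id hST fun _ _ _ _ h => h

theorem WidthGE.map {S : Set A} {ζ : Ordinal.{u}} (h : WidthGE S ζ) {T : Set B} (f : A → B)
    (hf : Set.MapsTo f S T)
    (hi : ∀ x ∈ S, ∀ y ∈ S, IncompRel (· ≤ ·) x y → IncompRel (· ≤ ·) (f x) (f y)) :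
    WidthGE T ζ := by
  induction h generalizing T with
  | intro S ζ x hx _ ih =>
    refine ⟨T, ζ, fun c => f (x c), fun c => hf (hx c), fun c => ih c ?_ ?_⟩
    · exact fun y hy => ⟨hf hy.1, hi _ (hx c) y hy.1 hy.2⟩
    · exact fun y hy z hz => hi y hy.1 z hz.1

theorem WidthGE.superset {S T : Set A} {ζ : Ordinal.{u}} (h : WidthGE S ζ) (hST : S ⊆ T) :
    WidthGE T ζ :=
  h.map id hST fun _ _ _ _ h => h

theorem widthLE_empty (ζ : Ordinal.{u}) : WidthLE (∅ : Set A) ζ :=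
  widthLE_iff.2 fun _ h => h.elim

theorem widthLE_one {S : Set A} (h : ∀ x ∈ S, ∀ y ∈ S, ¬ IncompRel (· ≤ ·) x y) :
    WidthLE S (1 : Ordinal.{u}) :=
  widthLE_iff.2 fun x hx => ⟨0, zero_lt_one,
    (widthLE_empty 0).subset fun y hy => h x hx y hy.1 hy.2⟩

theorem widthGE_zero (S : Set A) : WidthGE S (0 : Ordinal.{u}) :=
  widthGE_iff.2 fun _ h => (not_lt_zero h).elim

theorem widthGE_one {S : Set A} (h : S.Nonempty) : WidthGE S (1 : Ordinal.{u}) := by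
  obtain ⟨x, hx⟩ := h
  refine widthGE_iff.2 fun c hc => ⟨x, hx, ?_⟩
  rw [Order.lt_one_iff.1 hc]
  exact widthGE_zero _

theorem WidthGE.of_forall_lt {S : Set A} {ζ : Ordinal.{u}} (hζ : Order.IsSuccLimit ζ)
    (h : ∀ c < ζ, WidthGE S c) : WidthGE S ζ :=
  widthGE_iff.2 fun c hc => widthGE_iff.1 (h _ (hζ.succ_lt hc)) c (Order.lt_succ c)

/-- Each chosen element lies in `S` or in `T` and lowers the corresponding bound; the natural sum is
strictly monotone in both. -/
theorem WidthLE.union {S T : Set A} {a b : Ordinal.{u}} (hS : WidthLE S a) (hT : WidthLE T b) :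
    WidthLE (S ∪ T) (natAdd a b) := by
  induction hS generalizing T b with
  | intro S a f hf hS ihS =>
  induction hT with
  | intro T b g hg hT ihT =>
    have hT' : WidthLE T b := ⟨T, b, g, hg, hT⟩
    refine widthLE_iff.2 fun x hx => ?_
    by_cases hxS : x ∈ S
    · refine ⟨_, natAdd_lt_natAdd_left b (hf x hxS), (ihS x hxS hT').subset ?_⟩
      rintro y ⟨hy | hy, hxy⟩
      exacts [Or.inl ⟨hy, hxy⟩, Or.inr hy]
    · have hxT := hx.resolve_left hxS
      refine ⟨_, natAdd_lt_natAdd_right a (hg x hxT), (ihT x hxT).subset ?_⟩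
      rintro y ⟨hy | hy, hxy⟩
      exacts [Or.inl hy, Or.inr ⟨hy, hxy⟩]

theorem WidthLE.exists_biUnion_lt {ι : Type*} {o : Ordinal.{u}} (ho : Ordinal.IsPrincipal natAdd o)
    (ho0 : 0 < o) (s : Finset ι) {S : ι → Set A} (h : ∀ i ∈ s, ∃ c < o, WidthLE (S i) c) :
    ∃ c < o, WidthLE (⋃ i ∈ s, S i) c := by
  classical
  induction s using Finset.induction_on with
  | empty => exact ⟨0, ho0, by simpa using widthLE_empty 0⟩
  | insert i s _ ih =>
    obtain ⟨a, ha, hSa⟩ := h i (Finset.mem_insert_self i s)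
    obtain ⟨b, hb, hSb⟩ := ih fun j hj => h j (Finset.mem_insert_of_mem hj)
    rw [Finset.set_biUnion_insert]
    exact ⟨_, ho ha hb, hSa.union hSb⟩

/-- Antichain sequences in `S` can be followed by long antichain sequences in `U`. -/
theorem WidthGE.add {S U : Set A} {a b : Ordinal.{u}} (hS : WidthGE S a) (hSU : S ⊆ U)
    (h : ∀ F : Set A, F.Finite → F ⊆ S → WidthGE {y ∈ U | ∀ x ∈ F, IncompRel (· ≤ ·) x y} b) :
    WidthGE U (b + a) := by
  induction hS generalizing U with
  | intro S a x hx _ ih =>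
    refine widthGE_iff.2 fun c hc => ?_
    -- Below `b`, skip `S` altogether (`F = ∅`). Otherwise `c = b + d` with `d < a`, and the next
    -- element is the one chosen in `S` for `d`. Elements chosen first contribute the right summand.
    rcases lt_or_ge c b with hcb | hcb
    · exact widthGE_iff.1 ((h ∅ Set.finite_empty (Set.empty_subset S)).superset
        (Set.sep_subset _ _)) c hcb
    obtain ⟨d, rfl⟩ := exists_add_of_le hcb
    have hd : d < a := by simpa using hc
    refine ⟨x ⟨d, hd⟩, hSU (hx _), ih ⟨d, hd⟩ (fun y hy => ⟨hSU hy.1, hy.2⟩) fun F hF hFS => ?_⟩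
    refine (h (insert (x ⟨d, hd⟩) F) (hF.insert _)
      (Set.insert_subset (hx _) fun y hy => (hFS hy).1)).superset fun y hy => ?_
    exact ⟨⟨hy.1, hy.2 _ (Set.mem_insert _ _)⟩, fun z hz => hy.2 z (Set.mem_insert_of_mem _ hz)⟩

end Game

/-! ### From rank bounds to the width -/

section Width

variable {A : Type u} [Preorder A]

/-- The elements by which the sequence `s` can be extended. -/
def Inco.extensions (s : Inco A) : Set A :=
  {y | ∀ x ∈ s.1, IncompRel (· ≤ ·) x y}

/-- The node obtained by extending `s` by one element. -/
def Inco.snoc (s : Inco A) (y : A) (hy : y ∈ s.extensions) : Inco A :=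
  ⟨s.1 ++ [y], by simp, by
    rw [List.pairwise_append]
    exact ⟨s.2.2, by simp, fun x hx z hz => List.mem_singleton.1 hz ▸ hy x hx⟩⟩

theorem Inco.extensions_of_eq_append {t s : Inco A} {y : A} (h : t.1 = s.1 ++ [y]) :
    t.extensions = perp s.extensions y := by
  ext z
  simp only [Inco.extensions, perp, h, Set.mem_ofPred_eq, List.mem_append, List.mem_singleton]
  constructor
  · exact fun hz => ⟨fun x hx => hz x (Or.inl hx), hz y (Or.inr rfl)⟩
  · rintro ⟨h1, h2⟩ x (hx | rfl)
    exacts [h1 x hx, h2]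

theorem Inco.mem_extensions_of_eq_append {t s : Inco A} {y : A} (h : t.1 = s.1 ++ [y]) :
    y ∈ s.extensions := by
  have hp := t.2.2
  rw [h, List.pairwise_append] at hp
  exact fun x hx => hp.2.2 x hx y (by simp)

variable [WellQuasiOrderedLE A]

theorem Inco.rank_le {S : Set A} {ζ : Ordinal.{u}} (h : WidthLE S ζ) (s : Inco A)
    (hs : s.extensions = S) : IsWellFounded.rank Inco.IsChild s ≤ ζ := by
  induction h generalizing s with
  | intro S ζ f hf _ ih =>
    rw [IsWellFounded.rank_eq]
    refine Ordinal.iSup_le fun ⟨t, y, ht⟩ => ?_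
    have hy : y ∈ S := hs ▸ Inco.mem_extensions_of_eq_append ht
    exact Order.succ_le_of_lt ((ih y hy t (by rw [Inco.extensions_of_eq_append ht, hs])).trans_lt
      (hf y hy))

theorem Inco.le_rank {S : Set A} {ζ : Ordinal.{u}} (h : WidthGE S ζ) (s : Inco A)
    (hs : s.extensions = S) : ζ ≤ IsWellFounded.rank Inco.IsChild s := by
  induction h generalizing s with
  | intro S ζ x hx _ ih =>
    refine le_of_forall_lt fun c hc => ?_
    have hy : x ⟨c, hc⟩ ∈ s.extensions := hs ▸ hx _
    refine (ih ⟨c, hc⟩ (s.snoc _ hy) ?_).trans_lt (IsWellFounded.rank_lt_of_rel ⟨_, rfl⟩)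
    rw [Inco.extensions_of_eq_append (s := s) (y := x ⟨c, hc⟩) rfl, hs]

theorem width_le {ζ : Ordinal.{u}} (h : WidthLE (Set.univ : Set A) ζ) : width A ≤ ζ := by
  refine Ordinal.iSup_le fun s => Order.succ_le_of_lt ?_
  obtain ⟨x, l, hs⟩ := List.exists_cons_of_ne_nil s.2.1
  obtain ⟨c, hc, h⟩ := widthLE_iff.1 h x (Set.mem_univ x)
  refine (Inco.rank_le (h.subset (S := s.extensions) fun y hy => ?_) s rfl).trans_lt hc
  exact ⟨Set.mem_univ y, hy x (by simp [hs])⟩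

theorem le_width {ζ : Ordinal.{u}} (h : WidthGE (Set.univ : Set A) ζ) : ζ ≤ width A := by
  refine le_of_forall_lt fun c hc => ?_
  obtain ⟨x, -, h⟩ := widthGE_iff.1 h c hc
  let s : Inco A := ⟨[x], by simp, by simp⟩
  have hs : c ≤ IsWellFounded.rank Inco.IsChild s :=
    Inco.le_rank h s (by ext y; simp [s, Inco.extensions, perp])
  exact (Order.lt_succ_of_le hs).trans_le
    (Ordinal.le_iSup (fun s : Inco A => Order.succ (IsWellFounded.rank Inco.IsChild s)) s)

end Width

/-! ### Products of initial segments: slicing and stacking -/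

section Box

open Ordinal Function

variable {n : ℕ}

/-- The product of the initial segments given by a tuple of ordinals. -/
def box (β : Fin n → Ordinal.{u}) : Set (Fin n → Ordinal.{u}) :=
  {y | ∀ i, y i < β i}

/-- The product of the powers of `ω` with the given exponents. -/
noncomputable abbrev omegaBox (α : Fin n → Ordinal.{u}) : Set (Fin n → Ordinal.{u}) :=
  box fun i => ω ^ α i

/-- Add `m` on the left to the coordinate `i`. -/
noncomputable def shift (i : Fin n) (m : Ordinal.{u}) (y : Fin n → Ordinal.{u}) :
    Fin n → Ordinal.{u} :=
  update y i (m + y i)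

theorem shift_apply_self (i : Fin n) (m : Ordinal.{u}) (y : Fin n → Ordinal.{u}) :
    shift i m y i = m + y i := by
  simp [shift]

theorem shift_apply_of_ne {i j : Fin n} (h : j ≠ i) (m : Ordinal.{u}) (y : Fin n → Ordinal.{u}) :
    shift i m y j = y j := by
  simp [shift, h]

theorem le_of_shift_le {i : Fin n} {m : Ordinal.{u}} {x y : Fin n → Ordinal.{u}}
    (h : shift i m x ≤ shift i m y) : x ≤ y := by
  intro j
  have hj := h j
  rcases eq_or_ne j i with rfl | hji
  · simpa [shift_apply_self] using hj
  · simpa [shift_apply_of_ne hji] using hj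

theorem mem_box_update_iff {β : Fin n → Ordinal.{u}} {i : Fin n} {δ : Ordinal.{u}}
    {y : Fin n → Ordinal.{u}} :
    y ∈ box (update β i δ) ↔ y i < δ ∧ ∀ j, j ≠ i → y j < β j := by
  constructor
  · exact fun h => ⟨by simpa using h i, fun j hj => by simpa [hj] using h j⟩
  · rintro ⟨h1, h2⟩ j
    rcases eq_or_ne j i with rfl | hj
    · simpa using h1
    · simpa [hj] using h2 j hj

theorem omegaBox_update (α : Fin n → Ordinal.{u}) (i : Fin n) (η : Ordinal.{u}) :
    omegaBox (update α i η) = box (update (fun j => ω ^ α j) i (ω ^ η)) := by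
  refine congrArg box (funext fun j => ?_)
  rcases eq_or_ne j i with rfl | hj
  · simp
  · simp [hj]

theorem widthGE_box_update_mul {β : Fin n → Ordinal.{u}} {i j : Fin n} (hij : j ≠ i)
    (hβ : IsPrincipal (· + ·) (β j)) (hβ1 : 1 < β j) {δ ζ : Ordinal.{u}}
    (h : WidthGE (box (update β i δ)) ζ) (k : ℕ) :
    WidthGE (box (update β i (δ * k))) (ζ * k) := by
  induction k with
  | zero => simpa using widthGE_zero _
  | succ k ih =>
    push_cast
    rw [mul_add_one, mul_add_one]
    refine WidthGE.add (S := {y ∈ box (update β i (δ * k + δ)) | δ * k ≤ y i})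
      (h.map (shift i (δ * k)) ?_ ?_) (Set.sep_subset _ _) ?_
    · intro y hy
      obtain ⟨h1, h2⟩ := mem_box_update_iff.1 hy
      refine ⟨mem_box_update_iff.2 ⟨?_, fun l hl => ?_⟩, ?_⟩
      · simpa [shift_apply_self] using h1
      · simpa [shift_apply_of_ne hl] using h2 l hl
      · simp [shift_apply_self]
    · exact fun x _ y _ hxy => ⟨fun hle => hxy.1 (le_of_shift_le hle),
        fun hle => hxy.2 (le_of_shift_le hle)⟩
    -- `m` exceeds the `j`-coordinates of `F`. The lower `k` copies, shifted by `m` along `j`, are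
    -- then below `F` in coordinate `i` and above it in coordinate `j`.
    · intro F hF hFS
      obtain ⟨m, hm, hmF⟩ : ∃ m < β j, ∀ x ∈ F, x j < m := by
        induction F, hF using Set.Finite.induction_on with
        | empty => exact ⟨1, hβ1, by simp⟩
        | @insert x F _ _ ih' =>
          obtain ⟨m, hm, hmF⟩ := ih' fun y hy => hFS (Set.mem_insert_of_mem _ hy)
          have hx : x j < β j :=
            (mem_box_update_iff.1 (hFS (Set.mem_insert x F)).1).2 j hij
          refine ⟨max m (x j + 1), max_lt hm (hβ hx hβ1), ?_⟩
          rintro y (rfl | hy)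
          · exact lt_max_of_lt_right (Order.lt_add_one_iff.2 le_rfl)
          · exact lt_max_of_lt_left (hmF y hy)
      refine ih.map (shift j m) (fun y hy => ?_) fun x _ y _ hxy =>
        ⟨fun hle => hxy.1 (le_of_shift_le hle), fun hle => hxy.2 (le_of_shift_le hle)⟩
      obtain ⟨h1, h2⟩ := mem_box_update_iff.1 hy
      refine ⟨mem_box_update_iff.2 ⟨?_, fun l hl => ?_⟩, fun x hx => ⟨fun hle => ?_, fun hle => ?_⟩⟩
      · rw [shift_apply_of_ne hij.symm]
        exact h1.trans_le le_self_add
      · rcases eq_or_ne l j with rfl | hlj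
        · rw [shift_apply_self]
          exact hβ hm (h2 l hl)
        · rw [shift_apply_of_ne hlj]
          exact h2 l hl
      · have := hle i
        rw [shift_apply_of_ne hij.symm] at this
        exact (this.trans_lt h1).not_ge (hFS hx).2
      · have := hle j
        rw [shift_apply_self] at this
        exact (le_self_add.trans this).not_gt (hmF x hx)

/-- The box is cut along coordinate `i` into `k` slabs, each a translate of the box of height `δ`.
-/
theorem exists_widthLE_box_update_mul {β : Fin n → Ordinal.{u}} {i : Fin n} {δ o : Ordinal.{u}}
    (ho : IsPrincipal natAdd o) (ho0 : 0 < o)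
    (h : ∃ c < o, WidthLE (box (update β i δ)) c) (k : ℕ) :
    ∃ c < o, WidthLE (box (update β i (δ * k))) c := by
  induction k with
  | zero =>
    refine ⟨0, ho0, (widthLE_empty 0).subset fun y hy => ?_⟩
    simpa using (mem_box_update_iff.1 hy).1
  | succ k ih =>
    obtain ⟨a, ha, hSa⟩ := ih
    obtain ⟨b, hb, hSb⟩ := h
    push_cast
    rw [mul_add_one]
    have hT : WidthLE {y ∈ box (update β i (δ * k + δ)) | δ * k ≤ y i} b := by
      have hback : ∀ y : Fin n → Ordinal.{u}, δ * k ≤ y i →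
          shift i (δ * k) (update y i (y i - δ * k)) = y := by
        intro y hy
        simp [shift, Ordinal.add_sub_cancel_of_le hy]
      refine hSb.of_map (fun y => update y i (y i - δ * k)) (fun y hy => ?_)
        fun x hx y hy hxy => ⟨fun hle => hxy.1 ?_, fun hle => hxy.2 ?_⟩
      · obtain ⟨h1, h2⟩ := mem_box_update_iff.1 hy.1
        refine mem_box_update_iff.2 ⟨?_, fun j hj => by simpa [hj] using h2 j hj⟩
        rw [← Ordinal.add_sub_cancel_of_le hy.2] at h1
        simpa using h1
      · rw [← hback x hx.2, ← hback y hy.2]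
        intro j
        have := hle j
        rcases eq_or_ne j i with rfl | hj
        · simpa [shift] using this
        · simpa [shift, hj] using this
      · rw [← hback x hx.2, ← hback y hy.2]
        intro j
        have := hle j
        rcases eq_or_ne j i with rfl | hj
        · simpa [shift] using this
        · simpa [shift, hj] using this
    refine ⟨_, ho ha hb, (hSa.union hT).subset fun y hy => ?_⟩
    rcases lt_or_ge (y i) (δ * k) with h | h
    · exact Or.inl (mem_box_update_iff.2 ⟨h, (mem_box_update_iff.1 hy).2⟩)
    · exact Or.inr ⟨hy, h⟩

theorem omegaBox_widthGE_mul {α : Fin n → Ordinal.{u}} {i j : Fin n} (hij : j ≠ i) (hj : α j ≠ 0)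
    {η ζ : Ordinal.{u}} (hη : η < α i) (h : WidthGE (omegaBox (update α i η)) ζ) (k : ℕ) :
    WidthGE (omegaBox α) (ζ * k) := by
  rw [omegaBox_update] at h
  refine (widthGE_box_update_mul hij (isPrincipal_add_omega0_opow _)
    (one_lt_opow.2 ⟨one_lt_omega0, hj⟩) h k).superset fun y hy l => ?_
  obtain ⟨h1, h2⟩ := mem_box_update_iff.1 hy
  rcases eq_or_ne l i with rfl | hl
  · exact h1.trans (opow_mul_lt_opow (natCast_lt_omega0 k) hη)
  · exact h2 l hl

theorem omegaBox_widthLE {α : Fin n → Ordinal.{u}} {o : Ordinal.{u}} (ho : IsPrincipal natAdd o)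
    (ho0 : 0 < o)
    (h : ∀ i, ∀ η < α i, ∃ c < o, WidthLE (omegaBox (update α i η)) c) :
    WidthLE (omegaBox α) o := by
  refine widthLE_iff.2 fun x hx => ?_
  obtain ⟨c, hc, hw⟩ := WidthLE.exists_biUnion_lt ho ho0 Finset.univ
    (S := fun i => {y ∈ omegaBox α | y i < x i}) fun i _ => by
      rcases eq_or_ne (α i) 0 with h0 | h0
      · refine ⟨0, ho0, (widthLE_empty 0).subset fun y hy => ?_⟩
        have : x i < ω ^ α i := hx i
        rw [h0, opow_zero, Order.lt_one_iff] at this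
        exact not_lt_zero (this ▸ hy.2)
      · obtain ⟨η, hη, k, hk⟩ := (lt_omega0_opow h0).1 (hx i)
        have hi := h i η hη
        rw [omegaBox_update] at hi
        obtain ⟨c, hc, hw⟩ := exists_widthLE_box_update_mul ho ho0 hi k
        exact ⟨c, hc, hw.subset fun y hy =>
          mem_box_update_iff.2 ⟨hy.2.trans hk, fun j _ => hy.1 j⟩⟩
  refine ⟨c, hc, hw.subset fun y hy => ?_⟩
  obtain ⟨i, hi⟩ : ∃ i, y i < x i := by
    by_contra! hcon
    exact hy.2.1 hcon
  simp only [Finset.mem_univ, Set.iUnion_true, Set.mem_iUnion]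
  exact ⟨i, hy.1, hi⟩

/-- Incomparability needs strict inequalities in opposite directions, hence two distinct coordinates
with nonzero exponents. -/
theorem omegaBox_widthLE_one {α : Fin n → Ordinal.{u}}
    (h : ∀ i j, i ≠ j → α i ≠ 0 → α j = 0) : WidthLE (omegaBox α) (1 : Ordinal.{u}) := by
  refine widthLE_one fun x hx y hy hxy => ?_
  have key : ∀ z w : Fin n → Ordinal.{u}, z ∈ omegaBox α → ¬ z ≤ w → ∃ i, w i < z i ∧ α i ≠ 0 := by
    intro z w hz hzw
    obtain ⟨i, hi⟩ : ∃ i, w i < z i := by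
      by_contra! hcon
      exact hzw hcon
    refine ⟨i, hi, fun h0 => ?_⟩
    have : z i < ω ^ α i := hz i
    rw [h0, opow_zero, Order.lt_one_iff] at this
    exact not_lt_zero (this ▸ hi)
  obtain ⟨i, hi, hi0⟩ := key x y hx hxy.1
  obtain ⟨j, hj, hj0⟩ := key y x hy hxy.2
  rcases eq_or_ne i j with rfl | hij
  · exact lt_asymm hi hj
  · exact hj0 (h i j hij hi0)

end Box

/-! ### Recursive behaviour of the exponent -/

section Exponent

open Ordinal Function

variable {n : ℕ} {α : Fin n → Ordinal.{u}}

open Classical in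
/-- The exponent of the width of `∏ i, ω ^ α i`. -/
noncomputable def widthExp (α : Fin n → Ordinal.{u}) : Ordinal.{u} :=
  if ∃ i j, i ≠ j ∧ α i ≠ 0 ∧ α j ≠ 0 then
    if ∃ i j, i ≠ j ∧ ω ≤ α i ∧ ω ≤ α j then tupleSum α else Ordinal.pred (tupleSum α)
  else 0

theorem widthExp_of_infinite {i j : Fin n} (hij : i ≠ j) (hi : ω ≤ α i) (hj : ω ≤ α j) :
    widthExp α = tupleSum α := by
  rw [widthExp, if_pos ⟨i, j, hij, (omega0_pos.trans_le hi).ne', (omega0_pos.trans_le hj).ne'⟩,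
    if_pos ⟨i, j, hij, hi, hj⟩]

theorem widthExp_of_eq_succ {i j : Fin n} (hij : i ≠ j) (hi : α i ≠ 0) (hj : α j ≠ 0)
    (hfin : ¬ ∃ i j, i ≠ j ∧ ω ≤ α i ∧ ω ≤ α j) {p : Ordinal.{u}}
    (hp : tupleSum α = Order.succ p) : widthExp α = p := by
  rw [widthExp, if_pos ⟨i, j, hij, hi, hj⟩, if_neg hfin, hp, Order.succ_eq_add_one, pred_add_one]

theorem widthExp_of_trivial (h : ¬ ∃ i j, i ≠ j ∧ α i ≠ 0 ∧ α j ≠ 0) : widthExp α = 0 :=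
  if_neg h

theorem widthExp_le_tupleSum (α : Fin n → Ordinal.{u}) : widthExp α ≤ tupleSum α := by
  unfold widthExp
  split_ifs
  exacts [le_rfl, pred_le_self _, zero_le]

/-- One of the two nonzero entries is finite, hence a successor; the other keeps the predecessor of
the sum nonzero. -/
theorem exists_tupleSum_eq_succ {i j : Fin n} (hij : i ≠ j) (hi : α i ≠ 0) (hj : α j ≠ 0)
    (hfin : ¬ ∃ i j, i ≠ j ∧ ω ≤ α i ∧ ω ≤ α j) :
    ∃ p, p ≠ 0 ∧ tupleSum α = Order.succ p := by
  have key : ∀ k l : Fin n, k ≠ l → α l ≠ 0 → α k ≠ 0 → α k < ω →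
      ∃ p, p ≠ 0 ∧ tupleSum α = Order.succ p := by
    intro k l hkl hl hk hkω
    obtain ⟨m, hm⟩ := lt_omega0.1 hkω
    obtain ⟨m, rfl⟩ : ∃ m', m = m' + 1 := Nat.exists_eq_succ_of_ne_zero (by
      rintro rfl
      exact hk (by simpa using hm))
    refine ⟨tupleSum (update α k m), fun h0 => hl ?_, ?_⟩
    · have := le_tupleSum (update α k m) l
      rw [h0, update_of_ne hkl.symm] at this
      exact le_zero_iff.1 this
    · rw [← tupleSum_update_add_one]
      congr 1
      rw [eq_comm, update_eq_self_iff, hm]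
      simp
  rcases lt_or_ge (α i) ω with h | h
  · exact key i j hij hj hi h
  · exact key j i hij.symm hi hj (not_le.1 fun h' => hfin ⟨i, j, hij, h, h'⟩)

theorem widthExp_update_lt {i j : Fin n} (hij : i ≠ j) (hi : α i ≠ 0) (hj : α j ≠ 0) (k : Fin n)
    {η : Ordinal.{u}} (hη : η < α k) : widthExp (update α k η) < widthExp α := by
  by_cases hinf : ∃ i j, i ≠ j ∧ ω ≤ α i ∧ ω ≤ α j
  · obtain ⟨a, b, hab, ha, hb⟩ := hinf
    rw [widthExp_of_infinite hab ha hb]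
    exact (widthExp_le_tupleSum _).trans_lt (tupleSum_update_lt α k hη)
  · obtain ⟨p, hp0, hp⟩ := exists_tupleSum_eq_succ hij hi hj hinf
    rw [widthExp_of_eq_succ hij hi hj hinf hp]
    by_cases hne : ∃ i j, i ≠ j ∧ update α k η i ≠ 0 ∧ update α k η j ≠ 0
    · obtain ⟨a, b, hab, ha, hb⟩ := hne
      have hinf' : ¬ ∃ i j, i ≠ j ∧ ω ≤ update α k η i ∧ ω ≤ update α k η j := by
        rintro ⟨c, d, hcd, hc, hd⟩
        have hle : update α k η ≤ α := update_le_self_iff.2 hη.le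
        exact hinf ⟨c, d, hcd, hc.trans (hle c), hd.trans (hle d)⟩
      obtain ⟨q, -, hq⟩ := exists_tupleSum_eq_succ hab ha hb hinf'
      rw [widthExp_of_eq_succ hab ha hb hinf' hq]
      have := tupleSum_update_lt α k hη
      rwa [hp, hq, Order.succ_lt_succ_iff] at this
    · rw [widthExp_of_trivial hne]
      exact pos_iff_ne_zero.2 hp0

theorem exists_le_widthExp_update {i j : Fin n} (hij : i ≠ j) (hi : α i ≠ 0) (hj : α j ≠ 0)
    {δ : Ordinal.{u}} (hδ : δ < widthExp α) :
    ∃ k, ∃ η < α k, δ ≤ widthExp (update α k η) := by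
  by_cases hinf : ∃ i j, i ≠ j ∧ ω ≤ α i ∧ ω ≤ α j
  · obtain ⟨a, b, hab, ha, hb⟩ := hinf
    rw [widthExp_of_infinite hab ha hb] at hδ
    obtain ⟨k, η, hη, hk⟩ := exists_le_tupleSum_update α hδ
    by_cases hinf' : ∃ i j, i ≠ j ∧ ω ≤ update α k η i ∧ ω ≤ update α k η j
    · obtain ⟨c, d, hcd, hc, hd⟩ := hinf'
      exact ⟨k, η, hη, by rwa [widthExp_of_infinite hcd hc hd]⟩
    obtain ⟨l, hlk, hl⟩ : ∃ l, l ≠ k ∧ ω ≤ α l := by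
      rcases eq_or_ne a k with rfl | hak
      exacts [⟨b, hab.symm, hb⟩, ⟨a, hak, ha⟩]
    have hηω : η < ω := by
      by_contra! h
      exact hinf' ⟨l, k, hlk, by simpa [hlk] using hl, by simpa using h⟩
    have hkω : ω ≤ α k := by
      by_contra! h
      have hak : a ≠ k := by rintro rfl; exact h.not_ge ha
      have hbk : b ≠ k := by rintro rfl; exact h.not_ge hb
      exact hinf' ⟨a, b, hab, by simpa [hak] using ha, by simpa [hbk] using hb⟩
    -- Lowering to `η` leaves fewer than two infinite entries, which costs one in `widthExp`. As `η`
    -- is finite and `α k` infinite, `η + 1` is still allowed and repays it.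
    have hsucc : Order.succ η < ω := isSuccLimit_omega0.succ_lt hηω
    refine ⟨k, Order.succ η, hsucc.trans_le hkω, ?_⟩
    rwa [widthExp_of_eq_succ hlk (by simpa [hlk] using (omega0_pos.trans_le hl).ne')
      (by simp) _ (tupleSum_update_add_one α k η)]
    rintro ⟨c, d, hcd, hc, hd⟩
    have hck : c ≠ k := by rintro rfl; simp at hc; exact hsucc.not_ge (by simpa using hc)
    have hdk : d ≠ k := by rintro rfl; simp at hd; exact hsucc.not_ge (by simpa using hd)
    exact hinf' ⟨c, d, hcd, by simpa [hck] using hc, by simpa [hdk] using hd⟩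
  · obtain ⟨p, hp0, hp⟩ := exists_tupleSum_eq_succ hij hi hj hinf
    rw [widthExp_of_eq_succ hij hi hj hinf hp] at hδ
    have hinf' : ∀ {k : Fin n} {η : Ordinal.{u}}, η ≤ α k →
        ¬ ∃ i j, i ≠ j ∧ ω ≤ update α k η i ∧ ω ≤ update α k η j := by
      rintro k η hη ⟨c, d, hcd, hc, hd⟩
      have hle : update α k η ≤ α := update_le_self_iff.2 hη
      exact hinf ⟨c, d, hcd, hc.trans (hle c), hd.trans (hle d)⟩
    have hlt : Order.succ δ < tupleSum α := by rwa [hp, Order.succ_lt_succ_iff]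
    obtain ⟨k, η, hη, hk⟩ := exists_le_tupleSum_update α hlt
    by_cases hne : ∃ i j, i ≠ j ∧ update α k η i ≠ 0 ∧ update α k η j ≠ 0
    · obtain ⟨a, b, hab, ha, hb⟩ := hne
      obtain ⟨q, -, hq⟩ := exists_tupleSum_eq_succ hab ha hb (hinf' hη.le)
      refine ⟨k, η, hη, ?_⟩
      rw [widthExp_of_eq_succ hab ha hb (hinf' hη.le) hq]
      rwa [hq, Order.succ_le_succ_iff] at hk
    rcases eq_or_ne δ 0 with rfl | hδ0
    · exact ⟨k, η, hη, zero_le⟩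
    -- Here the lowering left at most one nonzero entry, so its exponent is 0, too small for `δ ≠
    -- 0`. If `α k > 1`, lower it to 1 instead; if `α k = 1`, keep it and lower `α l`.
    obtain ⟨l, hlk, hl⟩ : ∃ l, l ≠ k ∧ α l ≠ 0 := by
      rcases eq_or_ne i k with rfl | hik
      exacts [⟨j, hij.symm, hj⟩, ⟨i, hik, hi⟩]
    obtain rfl : η = 0 := by
      by_contra h
      exact hne ⟨l, k, hlk, by simpa [hlk] using hl, by simpa using h⟩
    have hone := tupleSum_update_add_one α k 0
    rcases (Order.succ_le_of_lt hη).lt_or_eq with hk1 | hk1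
    · refine ⟨k, _, hk1, ?_⟩
      rw [widthExp_of_eq_succ hlk (by simpa [hlk] using hl) (by simp) (hinf' hk1.le) hone]
      exact (Order.le_succ δ).trans hk
    rw [hk1, update_eq_self, hp, Order.succ_eq_succ_iff] at hone
    rw [hone] at hδ
    obtain ⟨c, ξ, hξ, hc⟩ := exists_le_tupleSum_update _ hδ
    have hck : c ≠ k := by
      rintro rfl
      simp at hξ
    obtain rfl : c = l := by
      by_contra hcl
      exact hne ⟨c, l, hcl, (zero_le.trans_lt hξ).ne', by simpa [hlk] using hl⟩
    rw [update_of_ne hck] at hξ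
    rcases eq_or_ne ξ 0 with rfl | hξ0
    · obtain ⟨d, ν, hν, -⟩ := exists_le_tupleSum_update _ ((pos_iff_ne_zero.2 hδ0).trans_le hc)
      have hdc : d ≠ c := by
        rintro rfl
        simp at hν
      rw [update_of_ne hdc] at hν
      exact (hne ⟨d, c, hdc, (zero_le.trans_lt hν).ne', by simpa [hlk] using hl⟩).elim
    refine ⟨c, ξ, hξ, ?_⟩
    have hT : tupleSum (update α c ξ) = Order.succ (tupleSum (update (update α k 0) c ξ)) := by
      rw [update_comm hck.symm, ← tupleSum_update_add_one, hk1]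
      congr 1
      rw [eq_comm, update_eq_self_iff, update_of_ne hck.symm]
    rwa [widthExp_of_eq_succ hlk (by simpa using hξ0)
      (by simpa [hck.symm] using (zero_le.trans_lt hη).ne') (hinf' hξ.le) hT]

end Exponent

/-! ### The two bounds and the stated exponent -/

section Main

open Ordinal Function

theorem omegaBox_widthGE_widthExp {n : ℕ} (α : Fin n → Ordinal.{u}) :
    WidthGE (omegaBox α) (ω ^ widthExp α) := by
  induction α using WellFoundedLT.induction with
  | _ α ih =>
    rcases eq_or_ne (widthExp α) 0 with h0 | h0
    · rw [h0, opow_zero]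
      exact widthGE_one ⟨fun _ => 0, fun i => opow_pos _ omega0_pos⟩
    obtain ⟨i, j, hij, hi, hj⟩ : ∃ i j, i ≠ j ∧ α i ≠ 0 ∧ α j ≠ 0 := by
      by_contra h
      exact h0 (widthExp_of_trivial h)
    refine WidthGE.of_forall_lt (isSuccLimit_opow_left isSuccLimit_omega0 h0) fun c hc => ?_
    obtain ⟨δ, hδ, m, hm⟩ := (lt_omega0_opow h0).1 hc
    obtain ⟨k, η, hη, hk⟩ := exists_le_widthExp_update hij hi hj hδ
    obtain ⟨l, hlk, hl⟩ : ∃ l, l ≠ k ∧ α l ≠ 0 := by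
      rcases eq_or_ne i k with rfl | hik
      exacts [⟨j, hij.symm, hj⟩, ⟨i, hik, hi⟩]
    exact (omegaBox_widthGE_mul hlk hl hη ((ih _ (update_lt_self_iff.2 hη)).mono
      (opow_le_opow_right omega0_pos hk)) m).mono hm.le

theorem omegaBox_widthLE_widthExp {n : ℕ} (α : Fin n → Ordinal.{u}) :
    WidthLE (omegaBox α) (ω ^ widthExp α) := by
  induction α using WellFoundedLT.induction with
  | _ α ih =>
    by_cases h : ∃ i j, i ≠ j ∧ α i ≠ 0 ∧ α j ≠ 0
    · obtain ⟨i, j, hij, hi, hj⟩ := h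
      refine omegaBox_widthLE (isPrincipal_natAdd_omega0_opow _) (opow_pos _ omega0_pos)
        fun k η hη => ⟨_, ?_, ih _ (update_lt_self_iff.2 hη)⟩
      exact (opow_lt_opow_iff_right one_lt_omega0).2 (widthExp_update_lt hij hi hj k hη)
    · rw [widthExp_of_trivial h, opow_zero]
      refine omegaBox_widthLE_one fun i j hij hi => ?_
      by_contra hj
      exact h ⟨i, j, hij, hi, hj⟩

/-- The boxes live one universe above the product of the `ToType`s; rank bounds with values in
`Ordinal.{u}` transfer along maps preserving incomparability. -/
theorem width_pi_omega0_opow {n : ℕ} (α : Fin n → Ordinal.{u}) :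
    width (∀ i, (ω ^ α i).ToType) = ω ^ widthExp α := by
  refine le_antisymm (width_le ?_) (le_width ?_)
  · refine (omegaBox_widthLE_widthExp α).of_map (fun y i => (ToType.mk.symm (y i)).1)
      (fun y _ i => (ToType.mk.symm (y i)).2) fun x _ y _ hxy =>
        ⟨fun hle => hxy.1 fun i => ?_, fun hle => hxy.2 fun i => ?_⟩
    · exact ToType.mk.symm.le_iff_le.1 (hle i)
    · exact ToType.mk.symm.le_iff_le.1 (hle i)
  · classical
    refine (omegaBox_widthGE_widthExp α).map
      (fun y i => if h : y i < ω ^ α i then ToType.mk ⟨y i, h⟩ else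
        ToType.mk ⟨0, opow_pos _ omega0_pos⟩)
      (Set.mapsTo_univ _ _) fun x hx y hy hxy => ?_
    have hx' : ∀ i, x i < ω ^ α i := hx
    have hy' : ∀ i, y i < ω ^ α i := hy
    simp only [hx', hy', dite_true]
    exact ⟨fun hle => hxy.1 fun i => ToType.mk.le_iff_le.1 (hle i),
      fun hle => hxy.2 fun i => ToType.mk.le_iff_le.1 (hle i)⟩

theorem widthExp_of_antitone {n : ℕ} {α : Fin (n + 1) → Ordinal.{u}} (hα : Antitone α)
    (h : ¬ ∀ i : Fin n, α i.succ = 0) :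
    widthExp α = natAdd (α 0) (tupleSum (fun i : Fin n => α i.succ) - 1) := by
  push Not at h
  obtain ⟨i, hi⟩ := h
  have h0i : (0 : Fin (n + 1)) ≠ i.succ := (Fin.succ_ne_zero i).symm
  have h0 : α 0 ≠ 0 := fun h0 => hi (le_zero_iff.1 (h0 ▸ hα (Fin.zero_le _)))
  by_cases hinf : ∃ j : Fin n, ω ≤ α j.succ
  · obtain ⟨j, hj⟩ := hinf
    rw [widthExp_of_infinite (Fin.succ_ne_zero j).symm (hj.trans (hα (Fin.zero_le _))) hj,
      tupleSum_succ]
    have hω : ω ≤ tupleSum fun i : Fin n => α i.succ :=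
      hj.trans (le_tupleSum (fun i : Fin n => α i.succ) j)
    congr 1
    -- An infinite `σ` satisfies `1 + σ = σ`, so `σ - 1 = σ`.
    conv_rhs => rw [← one_add_of_omega0_le hω]
    rw [Ordinal.add_sub_cancel]
  · push Not at hinf
    obtain ⟨m, hm⟩ := lt_omega0.1 (tupleSum_lt_omega0 _ hinf)
    obtain ⟨m, rfl⟩ : ∃ m', m = m' + 1 := Nat.exists_eq_succ_of_ne_zero (by
      rintro rfl
      have := le_tupleSum (fun i : Fin n => α i.succ) i
      rw [hm, Nat.cast_zero] at this
      exact hi (le_zero_iff.1 this))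
    have hs : tupleSum (fun i : Fin n => α i.succ) - 1 = m := by
      rw [hm, add_comm m 1, Nat.cast_add, Nat.cast_one, Ordinal.add_sub_cancel]
    rw [hs]
    refine widthExp_of_eq_succ h0i h0 hi ?_ ?_
    · rintro ⟨a, b, hab, ha, hb⟩
      cases a using Fin.cases with
      | succ a => exact (hinf a).not_ge ha
      | zero =>
        cases b using Fin.cases with
        | succ b => exact (hinf b).not_ge hb
        | zero => exact hab rfl
    · rw [tupleSum_succ, hm, ← natAdd_succ]
      simp

end Main

end WqoWidth

theorem mainTheorem7 (n : ℕ) (α : Fin (n + 1) → Ordinal.{u}) (hα : Antitone α) :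
    ((∀ i : Fin n, α i.succ = 0) →
      WqoWidth.width (∀ i : Fin (n + 1), (Ordinal.omega0.{u} ^ α i).ToType) = 1) ∧
    (¬ (∀ i : Fin n, α i.succ = 0) →
      WqoWidth.width (∀ i : Fin (n + 1), (Ordinal.omega0.{u} ^ α i).ToType) =
        Ordinal.omega0.{u} ^
          WqoWidth.natAdd (α 0)
            (WqoWidth.natSum (List.ofFn fun i : Fin n => α i.succ) - 1)) := by
  rw [WqoWidth.width_pi_omega0_opow]
  refine ⟨fun h => ?_, fun h => by rw [WqoWidth.widthExp_of_antitone hα h]; rfl⟩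
  rw [WqoWidth.widthExp_of_trivial, Ordinal.opow_zero]
  rintro ⟨i, j, hij, hi, hj⟩
  cases i using Fin.cases with
  | succ i => exact hi (h i)
  | zero =>
    cases j using Fin.cases with
    | succ j => exact hj (h j)
    | zero => exact hij rfl
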